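/- Let $k$ be $\mathbb{R}$ or $\mathbb{C}$, let $\mathfrak g$ be a finite-dimensional Lie algebra over $k$, and let $\mathfrak g_0\subset\mathfrak g$ be a subalgebra (of arbitrary codimension) such that the pair $(\mathfrak g,\mathfrak g_0)$ is effective, i.e. $\mathfrak g_0$ contains no non-zero ideal of $\mathfrak g$. Let $\mathfrak h$ be a subalgebra of codimension $1$ in $\mathfrak g$ containing $\mathfrak g_0$, and let $\mathfrak b_0$ be the largest ideal of $\mathfrak h$ contained in $\mathfrak g_0$. Suppose that the Lie algebra $\mathfrak h/\mathfrak b_0$ is simple (that is, non-abelian and without proper non-zero ideals). Consider the isotropy module $\mathfrak g/\mathfrak g_0$, i.e. the $\mathfrak g_0$-module with action $x.(y+\mathfrak g_0)=[x,y]+\mathfrak g_0$ for $x\in\mathfrak g_0$, $y\in\mathfrak g$. Then there is a one-dimensional $\mathfrak g_0$-submodule $W\subset\mathfrak g/\mathfrak g_0$ complementary to the submodule $\mathfrak h/\mathfrak g_0$, i.e. $\mathfrak g/\mathfrak g_0=W\oplus\mathfrak h/\mathfrak g_0$. -/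

import Mathlib

namespace LiePair

variable {k g : Type*} [Field k] [LieRing g] [LieAlgebra k g]

/-- The pair `(g, g₀)` is effective: `g₀` contains no non-zero ideal of `g`. -/
def IsEffective (g₀ : LieSubalgebra k g) : Prop :=
  ∀ I : LieIdeal k g, (∀ x ∈ I, x ∈ g₀) → I = ⊥

/-- The largest ideal of the subalgebra `h` that is contained in `g₀`: the sum of all such ideals
(see `isGreatest_largestIdeal`). -/
def largestIdeal (g₀ h : LieSubalgebra k g) : LieIdeal k h :=
  sSup {I : LieIdeal k h | ∀ x ∈ I, (x : g) ∈ g₀}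

theorem isGreatest_largestIdeal (g₀ h : LieSubalgebra k g) :
    IsGreatest {I : LieIdeal k h | ∀ x ∈ I, (x : g) ∈ g₀} (largestIdeal g₀ h) := by
  refine ⟨?_, fun I hI => le_sSup hI⟩
  have key : (largestIdeal g₀ h).toSubmodule ≤ g₀.toSubmodule.comap h.toSubmodule.subtype := by
    rw [largestIdeal, LieSubmodule.sSup_toSubmodule]
    refine sSup_le ?_
    rintro _ ⟨I, hI, rfl⟩ x hx
    exact hI x hx
  exact fun x hx => key hx

/-- The isotropy module `g / g₀` of the pair `(g, g₀)`, a Lie module over `g₀` with the action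
`x • (y + g₀) = [x, y] + g₀`. -/
abbrev IsotropyModule (g₀ : LieSubalgebra k g) : Type _ :=
  g ⧸ g₀.toLieSubmodule

/-- A subalgebra `h ⊇ g₀`, seen as a `g₀`-submodule of `g`. -/
def overalgebraSubmodule {g₀ h : LieSubalgebra k g} (hle : g₀ ≤ h) : LieSubmodule k g₀ g :=
  { h.toSubmodule with
    lie_mem := fun {x _} hm => h.lie_mem (hle x.2) hm }

/-- The submodule `h / g₀` of the isotropy module `g / g₀`, for a subalgebra `h ⊇ g₀`. -/
def isotropySubmodule {g₀ h : LieSubalgebra k g} (hle : g₀ ≤ h) :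
    LieSubmodule k g₀ (IsotropyModule g₀) :=
  (overalgebraSubmodule hle).map (LieSubmodule.Quotient.mk' g₀.toLieSubmodule)

end LiePair

open LieAlgebra Module

namespace LiePair

variable {K L S : Type*} [Field K] [LieRing L] [LieAlgebra K L] [LieRing S] [LieAlgebra K S]

/-! The aim is a splitting `g = m ⊕ c` into ideals with `m ⊆ h` and `c ∩ h ⊆ g₀`. Then the
`c`-component `e` of any element outside `h` works: `m` kills `e`, and for `v ∈ c` the bracket `⁅v,
e⁆` is a multiple of `e` plus an element of `c ∩ h ⊆ g₀`. As `h` has codimension one, it is solvable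
modulo an ideal `m` of `g` (`exists_lieIdeal_derivedSeries_le`). By effectiveness an ideal of `g`
inside `h` that dies in the simple quotient `h / b₀` is zero. Hence `m` maps onto `h / b₀`
(otherwise `h` would be solvable) and meets the radical trivially, so its Killing orthogonal `c` is
a complement. Finally `c ∩ h` commutes with `m`, so its image in `h / b₀` is central, hence zero. -/

/-- The image of an ideal under a surjection onto a simple Lie algebra is zero or everything. -/
theorem forall_apply_eq_zero_or_surjOn_of_isSimple [IsSimple K S] (π : L →ₗ⁅K⁆ S)
    (hπ : Function.Surjective π) (I : LieIdeal K L) :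
    (∀ x ∈ I, π x = 0) ∨ ∀ y, ∃ x ∈ I, π x = y := by
  rcases IsSimple.eq_bot_or_eq_top (I.map π) with h | h
  · refine .inl fun x hx => ?_
    simpa [h] using LieIdeal.mem_map (f := π) hx
  · refine .inr fun y => ?_
    obtain ⟨x, hx⟩ := LieIdeal.mem_map_of_surjective (I := I) hπ
      (h ▸ LieSubmodule.mem_top y : y ∈ I.map π)
    exact ⟨x, x.2, hx⟩

theorem not_isSolvable_of_isSimple [IsSimple K S] : ¬ IsSolvable S := by
  intro _
  have := IsSimple.nontrivial K S
  have h : radical K S = ⊥ := HasTrivialRadical.radical_eq_bot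
  rw [radical_eq_top_of_isSolvable] at h
  exact top_ne_bot h

/-- A solvable ideal is killed by every surjection onto a simple Lie algebra. -/
theorem apply_eq_zero_of_isSolvable_of_isSimple [IsSimple K S] (π : L →ₗ⁅K⁆ S)
    (hπ : Function.Surjective π) (I : LieIdeal K L) [IsSolvable I] {x : L} (hx : x ∈ I) :
    π x = 0 := by
  refine (forall_apply_eq_zero_or_surjOn_of_isSimple π hπ I).resolve_right (fun h => ?_) x hx
  refine not_isSolvable_of_isSimple (K := K) (S := S) ?_
  refine Function.Surjective.lieAlgebra_isSolvable (f := π.comp I.incl) fun y => ?_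
  obtain ⟨x, hx, rfl⟩ := h y
  exact ⟨⟨x, hx⟩, rfl⟩

/-! ### Codimension-one subalgebras are solvable modulo an ideal -/

/-- The descending chain `h = F 0 ≥ F 1 ≥ …` with `F (n + 1) = {x ∈ F n | ⁅x, L⁆ ⊆ F n}`. -/
def coreSeries (h : LieSubalgebra K L) : ℕ → Submodule K L
  | 0 => h.toSubmodule
  | n + 1 =>
    { carrier := {x | x ∈ coreSeries h n ∧ ∀ y : L, ⁅x, y⁆ ∈ coreSeries h n}
      add_mem' := fun ha hb => ⟨add_mem ha.1 hb.1, fun y => by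
        rw [add_lie]; exact add_mem (ha.2 y) (hb.2 y)⟩
      zero_mem' := ⟨zero_mem _, fun y => by simp⟩
      smul_mem' := fun c x hx => ⟨Submodule.smul_mem _ c hx.1, fun y => by
        rw [smul_lie]; exact Submodule.smul_mem _ c (hx.2 y)⟩ }

theorem mem_coreSeries_succ {h : LieSubalgebra K L} {n : ℕ} {x : L} :
    x ∈ coreSeries h (n + 1) ↔ x ∈ coreSeries h n ∧ ∀ y : L, ⁅x, y⁆ ∈ coreSeries h n :=
  Iff.rfl

theorem coreSeries_antitone (h : LieSubalgebra K L) : Antitone (coreSeries h) :=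
  antitone_nat_of_succ_le fun _ _ hx => hx.1

variable {h : LieSubalgebra K L} {e : L}

theorem lie_mem_coreSeries (he : ∀ y, ∃ c : K, y - c • e ∈ h) (n : ℕ) {x y : L}
    (hx : x ∈ coreSeries h n) (hy : y ∈ h) : ⁅y, x⁆ ∈ coreSeries h n := by
  induction n generalizing x y with
  | zero => exact h.lie_mem hy hx
  | succ n ih =>
    refine ⟨ih hx.1 hy, fun z => ?_⟩
    obtain ⟨c, hc⟩ := he ⁅y, z⁆
    -- Jacobi, with `⁅y, z⁆` split into a multiple of `e` and a part in `h`, to which induction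
    -- applies.
    have h1 : ⁅⁅y, x⁆, z⁆ = ⁅y, ⁅x, z⁆⁆ - (c • ⁅x, e⁆ - ⁅⁅y, z⁆ - c • e, x⁆) := by
      rw [sub_lie, smul_lie, ← lie_skew x e, smul_neg, lie_lie y x z, ← lie_skew ⁅y, z⁆ x]
      abel
    rw [h1]
    exact sub_mem (ih (hx.2 z) hy) (sub_mem (Submodule.smul_mem _ c (hx.2 e)) (ih hx.1 hc))

/-- For `n = 0`, `x` and `y` act on the line `L / h` by scalars, which commute. For larger `n`, `⁅y,
z⁆` and `⁅x, z⁆` lie in `h`, which normalises every term of the chain. -/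
theorem lie_mem_coreSeries_succ (he : ∀ y, ∃ c : K, y - c • e ∈ h) (n : ℕ) {x y : L}
    (hx : x ∈ coreSeries h n) (hy : y ∈ coreSeries h n) : ⁅x, y⁆ ∈ coreSeries h (n + 1) := by
  have hle := coreSeries_antitone h (Nat.zero_le n)
  refine ⟨lie_mem_coreSeries he n hy (hle hx), fun z => ?_⟩
  rw [lie_lie]
  cases n with
  | zero =>
    replace hx : x ∈ h := hx
    replace hy : y ∈ h := hy
    obtain ⟨c, hc⟩ := he z
    obtain ⟨a, ha⟩ := he ⁅x, e⁆
    obtain ⟨b, hb⟩ := he ⁅y, e⁆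
    have h1 : ⁅x, ⁅y, z⁆⁆ - ⁅y, ⁅x, z⁆⁆ =
        ⁅x, ⁅y, z - c • e⁆⁆ - ⁅y, ⁅x, z - c • e⁆⁆
          + c • (⁅x, ⁅y, e⁆ - b • e⁆ - ⁅y, ⁅x, e⁆ - a • e⁆
            + (b • (⁅x, e⁆ - a • e) - a • (⁅y, e⁆ - b • e))) := by
      simp only [lie_sub, lie_smul, smul_sub, smul_add, smul_smul, mul_comm b a]
      abel
    rw [h1]
    exact add_mem (sub_mem (h.lie_mem hx (h.lie_mem hy hc)) (h.lie_mem hy (h.lie_mem hx hc)))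
      (h.smul_mem c (add_mem (sub_mem (h.lie_mem hx hb) (h.lie_mem hy ha))
        (sub_mem (h.smul_mem b ha) (h.smul_mem a hb))))
  | succ n =>
    have key : ∀ {u v : L}, u ∈ coreSeries h (n + 1) → v ∈ coreSeries h (n + 1) →
        ⁅u, ⁅v, z⁆⁆ ∈ coreSeries h (n + 1) := fun {u v} hu hv => by
      rw [← lie_skew]
      exact neg_mem (lie_mem_coreSeries he _ hu (coreSeries_antitone h (Nat.zero_le n) (hv.2 z)))
    exact sub_mem (key hx hy) (key hy hx)

theorem coe_mem_coreSeries_of_mem_derivedSeries (he : ∀ y, ∃ c : K, y - c • e ∈ h) (n : ℕ) {x : h}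
    (hx : x ∈ derivedSeries K h n) : (x : L) ∈ coreSeries h n := by
  induction n generalizing x with
  | zero => exact x.2
  | succ n ih =>
    rw [derivedSeries_def, derivedSeriesOfIdeal_succ, ← LieSubmodule.mem_toSubmodule,
      LieSubmodule.lieIdeal_oper_eq_linear_span'] at hx
    induction hx using Submodule.span_induction with
    | mem x hx =>
      obtain ⟨a, ha, b, hb, rfl⟩ := hx
      exact lie_mem_coreSeries_succ he n (ih ha) (ih hb)
    | zero => exact zero_mem _
    | add a b _ _ ha hb => exact add_mem ha hb
    | smul c a _ ha => exact Submodule.smul_mem _ c ha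

/-- A subalgebra `h` of codimension at most one is solvable modulo an ideal of the whole algebra
contained in `h`. -/
theorem exists_lieIdeal_derivedSeries_le [FiniteDimensional K L]
    (he : ∀ y, ∃ c : K, y - c • e ∈ h) :
    ∃ m : LieIdeal K L, (∀ x ∈ m, x ∈ h) ∧
      ∃ n, ∀ x ∈ derivedSeries K h n, (x : L) ∈ m := by
  obtain ⟨n, hn⟩ := IsArtinian.monotone_stabilizes
    (⟨fun n => OrderDual.toDual (coreSeries h n), fun _ _ hab => coreSeries_antitone h hab⟩ :
      ℕ →o (Submodule K L)ᵒᵈ)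
  -- Where the chain stabilises, bracketing with `L` does not leave the term, so it is an ideal.
  have hs : coreSeries h n = coreSeries h (n + 1) := hn (n + 1) n.le_succ
  refine ⟨{ coreSeries h n with lie_mem := fun {x y} hy => ?_ },
    fun x hx => coreSeries_antitone h (Nat.zero_le n) hx, n,
    fun x hx => coe_mem_coreSeries_of_mem_derivedSeries he n hx⟩
  have hy' : y ∈ coreSeries h (n + 1) := hs ▸ hy
  rw [← lie_skew]
  exact neg_mem (s := coreSeries h n) (hy'.2 x)

/-! ### The complementary ideals -/

/-- An ideal meeting the radical trivially is complemented by its Killing orthogonal. -/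
theorem isCompl_killingCompl_of_disjoint_radical [CharZero K] [FiniteDimensional K L]
    (I : LieIdeal K L) (hI : Disjoint I (radical K L)) : IsCompl I I.killingCompl := by
  suffices Disjoint I I.killingCompl by
    rwa [← LieSubmodule.isCompl_toSubmodule, I.toSubmodule_killingCompl,
      LinearMap.BilinForm.isCompl_orthogonal_iff_disjoint (LieModule.traceForm_isSymm K L L).isRefl,
      ← I.toSubmodule_killingCompl, LieSubmodule.disjoint_toSubmodule]
  -- Cartan's criterion: the Killing form pairs the intersection with itself to zero.
  have hsol : IsSolvable (I ⊓ I.killingCompl : LieIdeal K L) := by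
    refine LieIdeal.isSolvable_of_killingForm_apply_lie_eq_zero _ fun x hx y hy => ?_
    have hy' := LieSubmodule.lie_le_left _ _ hy
    exact (LieIdeal.mem_killingCompl K L I).mp (LieSubmodule.mem_inf _ _ _ |>.mp hy').2 x
      (LieSubmodule.mem_inf _ _ _ |>.mp hx).1
  rw [disjoint_iff, ← le_bot_iff, ← hI.eq_bot]
  exact le_inf inf_le_left ((LieIdeal.solvable_iff_le_radical K L _).mp hsol)

/-- The projection of a Lie algebra onto the quotient by an ideal, as a Lie algebra morphism. -/
def quotientLieHom (I : LieIdeal K L) : L →ₗ⁅K⁆ L ⧸ I :=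
  { (LieSubmodule.Quotient.mk' I : L →ₗ[K] L ⧸ I) with
    map_lie' := fun {x y} => LieSubmodule.Quotient.mk_bracket I x y }

theorem quotientLieHom_surjective (I : LieIdeal K L) : Function.Surjective (quotientLieHom I) :=
  LieSubmodule.Quotient.surjective_mk' I

theorem quotientLieHom_eq_zero_iff {I : LieIdeal K L} {x : L} : quotientLieHom I x = 0 ↔ x ∈ I :=
  LieSubmodule.Quotient.mk_eq_zero I

/-- For an effective pair with `h / b₀` simple there are complementary ideals `m ⊆ h` and `c` of the
whole algebra with `c ∩ h ⊆ g₀`. -/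
theorem exists_isCompl_lieIdeal [CharZero K] [FiniteDimensional K L] {g₀ : LieSubalgebra K L}
    (heff : IsEffective g₀) (he : ∀ y, ∃ c : K, y - c • e ∈ h)
    (hsimple : IsSimple K (h ⧸ largestIdeal g₀ h)) :
    ∃ m c : LieIdeal K L, IsCompl m c ∧ (∀ x ∈ m, x ∈ h) ∧ ∀ x ∈ c, x ∈ h → x ∈ g₀ := by
  set π := quotientLieHom (largestIdeal g₀ h)
  have hπ : Function.Surjective π := quotientLieHom_surjective _
  have hker : ∀ x : h, π x = 0 → (x : L) ∈ g₀ := fun x hx =>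
    (isGreatest_largestIdeal g₀ h).1 x (quotientLieHom_eq_zero_iff.mp hx)
  have hbot : ∀ I : LieIdeal K L, (hI : ∀ x ∈ I, x ∈ h) →
      (∀ x ∈ I.comap h.incl, π x = 0) → I = ⊥ := fun I hI hI0 =>
    heff I fun x hx => hker ⟨x, hI x hx⟩ (hI0 ⟨x, hI x hx⟩ hx)
  obtain ⟨m, hmh, n, hn⟩ := exists_lieIdeal_derivedSeries_le he
  have hm : ∀ y, ∃ x ∈ m.comap h.incl, π x = y := by
    refine (forall_apply_eq_zero_or_surjOn_of_isSimple π hπ _).resolve_left fun h0 => ?_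
    have hm0 := hbot m hmh h0
    have : IsSolvable h := IsSolvable.mk (R := K) (k := n) <| (LieSubmodule.eq_bot_iff _).mpr
      fun x hx => Subtype.ext (by simpa [hm0] using hn x hx)
    exact not_isSolvable_of_isSimple (K := K) hπ.lieAlgebra_isSolvable
  have hrad : Disjoint m (radical K L) := by
    rw [disjoint_iff]
    have hle : ∀ x ∈ m ⊓ radical K L, x ∈ h := fun x hx => hmh x hx.1
    refine hbot _ hle fun x hx => ?_
    have : IsSolvable ((m ⊓ radical K L : LieIdeal K L)) :=
      (LieIdeal.solvable_iff_le_radical K L _).mpr inf_le_right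
    have : IsSolvable ((m ⊓ radical K L).comap h.incl) := by
      let f : (m ⊓ radical K L).comap h.incl →ₗ⁅K⁆ (m ⊓ radical K L : LieIdeal K L) :=
        { toFun := fun x => ⟨x, x.2⟩
          map_add' := fun _ _ => rfl
          map_smul' := fun _ _ => rfl
          map_lie' := rfl }
      refine Function.Injective.lieAlgebra_isSolvable (f := f) fun a b hab => ?_
      have hab' : (f a : L) = f b := congrArg Subtype.val hab
      exact Subtype.ext (Subtype.ext hab')
    exact apply_eq_zero_of_isSolvable_of_isSimple π hπ _ hx
  have hc := isCompl_killingCompl_of_disjoint_radical m hrad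
  refine ⟨m, m.killingCompl, hc, hmh, fun x hx hxh => hker ⟨x, hxh⟩ ?_⟩
  suffices π ⟨x, hxh⟩ ∈ center K (h ⧸ largestIdeal g₀ h) by
    simpa using this
  rw [LieModule.mem_maxTrivSubmodule]
  intro y
  obtain ⟨a, ha, rfl⟩ := hm y
  have h0 : ⁅(a : L), x⁆ ∈ m ⊓ m.killingCompl :=
    ⟨lie_mem_left K L m _ _ ha, lie_mem_right K L m.killingCompl _ _ hx⟩
  rw [hc.inf_eq_bot, LieSubmodule.mem_bot] at h0
  rw [← LieHom.map_lie, show ⁅a, (⟨x, hxh⟩ : h)⁆ = 0 from Subtype.ext h0, map_zero]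

/-! ### The complement in the isotropy module -/

theorem mem_isotropySubmodule_mk {g₀ : LieSubalgebra K L} (hle : g₀ ≤ h) {x : L} :
    LieSubmodule.Quotient.mk' g₀.toLieSubmodule x ∈ isotropySubmodule hle ↔ x ∈ h := by
  refine ⟨fun hx => ?_, fun hx => LieSubmodule.mem_map_of_mem hx⟩
  obtain ⟨y, hy, hxy⟩ := (LieSubmodule.mem_map _).mp hx
  have : x - y ∈ g₀.toLieSubmodule := by
    rw [← LieSubmodule.Quotient.mk_eq_zero, map_sub, hxy, sub_self]
  simpa using add_mem (hle this) (show y ∈ h from hy)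

/-- An element `e` outside `h` with `[g₀, e] ⊆ k e + g₀` spans a one-dimensional complement of
`h / g₀` in the isotropy module. -/
theorem exists_isCompl_isotropySubmodule {g₀ : LieSubalgebra K L} (hle : g₀ ≤ h)
    (he : ∀ y, ∃ c : K, y - c • e ∈ h) (heh : e ∉ h)
    (hlie : ∀ x ∈ g₀, ∃ c : K, ⁅x, e⁆ - c • e ∈ g₀) :
    ∃ W : LieSubmodule K g₀ (IsotropyModule g₀),
      finrank K W = 1 ∧ IsCompl W (isotropySubmodule hle) := by
  set p := LieSubmodule.Quotient.mk' g₀.toLieSubmodule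
  have hp : Function.Surjective p := LieSubmodule.Quotient.surjective_mk' _
  have hpz : ∀ {x : L}, p x = 0 ↔ x ∈ g₀ := fun {x} => LieSubmodule.Quotient.mk_eq_zero _
  refine ⟨{ K ∙ p e with lie_mem := fun {x m} hm => ?_ }, ?_, ?_⟩
  · obtain ⟨a, rfl⟩ := Submodule.mem_span_singleton.mp hm
    obtain ⟨c, hc⟩ := hlie x x.2
    refine Submodule.mem_span_singleton.mpr ⟨a * c, ?_⟩
    have h1 : ⁅x, p e⁆ = c • p e := by
      rw [← LieModuleHom.map_lie, ← sub_eq_zero, ← map_smul, ← map_sub]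
      exact hpz.mpr hc
    rw [lie_smul, h1, smul_smul]
  · exact finrank_span_singleton fun h0 => heh (hle (hpz.mp h0))
  · rw [← LieSubmodule.isCompl_toSubmodule]
    change IsCompl (K ∙ p e) _
    constructor
    · rw [Submodule.disjoint_def]
      intro x hx hx'
      obtain ⟨a, rfl⟩ := Submodule.mem_span_singleton.mp hx
      rw [← map_smul] at hx'
      have hae : a • e ∈ h := (mem_isotropySubmodule_mk hle).mp hx'
      by_cases ha : a = 0
      · simp [ha]
      · exact absurd (by simpa [smul_smul, ha] using h.smul_mem a⁻¹ hae) heh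
    · rw [codisjoint_iff, Submodule.eq_top_iff']
      intro x
      obtain ⟨y, rfl⟩ := hp x
      obtain ⟨c, hc⟩ := he y
      rw [← sub_add_cancel y (c • e), map_add, add_comm, map_smul]
      exact Submodule.add_mem_sup (Submodule.smul_mem _ c (Submodule.mem_span_singleton_self _))
        ((mem_isotropySubmodule_mk hle).mpr hc)

theorem exists_smul_sub_mem_of_finrank_quotient_eq_one
    (hcodim : finrank K (L ⧸ h.toSubmodule) = 1) (he : e ∉ h) (y : L) :
    ∃ c : K, y - c • e ∈ h := by
  obtain ⟨c, hc⟩ := exists_smul_eq_of_finrank_eq_one hcodim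
    (x := h.toSubmodule.mkQ e) (by simpa using he) (h.toSubmodule.mkQ y)
  refine ⟨c, ?_⟩
  rw [← map_smul] at hc
  exact (Submodule.Quotient.eq h.toSubmodule).mp hc.symm

end LiePair

theorem mainTheorem8 {k g : Type*} [RCLike k] [LieRing g] [LieAlgebra k g]
    [FiniteDimensional k g] (g₀ h : LieSubalgebra k g)
    (heff : LiePair.IsEffective g₀)
    (hle : g₀ ≤ h)
    (hcodim : Module.finrank k (g ⧸ h.toSubmodule) = 1)
    (hsimple : LieAlgebra.IsSimple k (h ⧸ LiePair.largestIdeal g₀ h)) :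
    ∃ W : LieSubmodule k g₀ (LiePair.IsotropyModule g₀),
      Module.finrank k W = 1 ∧ IsCompl W (LiePair.isotropySubmodule hle) := by
  obtain ⟨e₀, he₀⟩ : ∃ e, e ∉ h := by
    by_contra! hall
    have : h.toSubmodule = ⊤ := Submodule.eq_top_iff'.mpr hall
    have : Subsingleton (g ⧸ h.toSubmodule) := Submodule.Quotient.subsingleton_iff.mpr this
    simp [finrank_zero_of_subsingleton] at hcodim
  have hspan := fun {e : g} => LiePair.exists_smul_sub_mem_of_finrank_quotient_eq_one (e := e) hcodim
  obtain ⟨m, c, hmc, hmh, hc⟩ := LiePair.exists_isCompl_lieIdeal heff (hspan he₀) hsimple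
  have hdecomp : ∀ x : g, ∃ a ∈ m, ∃ b ∈ c, a + b = x := fun x =>
    (LieSubmodule.mem_sup _ _ _).mp (hmc.sup_eq_top ▸ LieSubmodule.mem_top x)
  -- Since `m ⊆ h`, dropping the `m`-component of `e₀` leaves it outside `h`.
  obtain ⟨a, ha, e, hec, hae⟩ := hdecomp e₀
  have heh : e ∉ h := fun hh => he₀ (hae ▸ add_mem (hmh a ha) hh)
  refine LiePair.exists_isCompl_isotropySubmodule hle (hspan heh) heh fun x hx => ?_
  obtain ⟨u, hu, v, hv, rfl⟩ := hdecomp x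
  have hue : ⁅u, e⁆ = 0 := by
    have : ⁅u, e⁆ ∈ m ⊓ c := ⟨lie_mem_left k g m _ _ hu, lie_mem_right k g c _ _ hec⟩
    rwa [hmc.inf_eq_bot, LieSubmodule.mem_bot] at this
  obtain ⟨t, ht⟩ := hspan heh ⁅v, e⁆
  refine ⟨t, ?_⟩
  rw [add_lie, hue, zero_add]
  exact hc _ (sub_mem (lie_mem_right k g c _ _ hec) (c.smul_mem t hec)) ht
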